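/- Let $d\geq 1$, let $X=\mathbb R^d/\mathbb Z^d$, and for $x\in\mathbb R^d$ let $[x]$ denote its class in $X$. Let $T:X\to X$ be a hyperbolic toral endomorphism, i.e. $T([x])=[Mx]$ for some $d\times d$ integer matrix $M$, all of whose complex eigenvalues have modulus $\neq 1$. Let $\mathcal M_T(X)$ be the space of $T$-invariant Borel probability measures on $X$, with the weak topology (convergence against continuous functions). For $x\in\mathbb R^d$ let $$\omega(x)=\limsup_{(p,q)}\frac{-\log\|x-p/q\|}{\log q}\in[-\infty,\infty]$$ be its exponent of irrationality, where $\|\cdot\|$ is any norm on $\mathbb R^d$ (the choice does not affect $\omega$), the limsup is taken along any enumeration of the pairs $(p,q)$ with $p\in\mathbb Z^d$ and $q\geq 2$ an integer (not necessarily in lowest terms), and $-\log 0=\infty$; in particular $\omega(x)=\infty$ for $x\in\mathbb Q^d$. Since $\omega(x+m)=\omega(x)$ for $m\in\mathbb Z^d$, $\omega$ is a function on $X$. A point $[x]\in X$ is a Liouville point if $\omega(x)=\infty$, and is very well approximable if $\omega(x)>1+1/d$. A measure on $X$ is extremal if the set of very well approximable points has measure zero. Theorem. The set of measures $\mu\in\mathcal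 M_T(X)$ that give full measure to the set of Liouville points is comeager in $\mathcal M_T(X)$. In particular, generic invariant measures are not extremal: the set of $\mu\in\mathcal M_T(X)$ that are not extremal is comeager in $\mathcal M_T(X)$. -/

import Mathlib

open MeasureTheory Filter Topology

noncomputable section

namespace ToralLiouville

/-- The quotient map `ℝ^d → ℝ^d / ℤ^d`, `x ↦ [x]`. -/
def torusMk {d : ℕ} (x : Fin d → ℝ) : UnitAddTorus (Fin d) :=
  fun i => (x i : UnitAddCircle)

/-- `T` is a hyperbolic toral endomorphism: `T [x] = [M x]` for a `d × d` integer matrix `M`,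
all of whose complex eigenvalues have modulus `≠ 1`. -/
def IsHyperbolicToralEndomorphism {d : ℕ}
    (T : UnitAddTorus (Fin d) → UnitAddTorus (Fin d)) : Prop :=
  ∃ M : Matrix (Fin d) (Fin d) ℤ,
    (∀ x : Fin d → ℝ, T (torusMk x) = torusMk ((M.map (Int.cast : ℤ → ℝ)).mulVec x)) ∧
    ∀ z : ℂ, Module.End.HasEigenvalue (Matrix.toLin' (M.map (Int.cast : ℤ → ℂ))) z → ‖z‖ ≠ 1

/-- The space `M_T(X)` of `T`-invariant Borel probability measures on `X = ℝ^d / ℤ^d`, with the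
weak topology (the subspace topology from `ProbabilityMeasure X`). -/
abbrev InvariantMeasures {d : ℕ} (T : UnitAddTorus (Fin d) → UnitAddTorus (Fin d)) : Type :=
  {μ : ProbabilityMeasure (UnitAddTorus (Fin d)) //
    MeasurePreserving T (μ : Measure (UnitAddTorus (Fin d))) (μ : Measure (UnitAddTorus (Fin d)))}

/-- The quantity `-log ‖x - p/q‖ / log q` (sup norm), equal to `+∞` if `x = p/q` and `q ≥ 2`. -/
def approxQuality {d : ℕ} (x : Fin d → ℝ) (r : (Fin d → ℤ) × ℕ) : EReal :=
  -ENNReal.log (edist x (fun i => (r.1 i : ℝ) / (r.2 : ℝ))) / ((Real.log (r.2 : ℝ) : ℝ) : EReal)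

/-- The exponent of irrationality `ω(x) = limsup_{p/q} -log ‖x - p/q‖ / log q`. The limsup is over
all pairs `(p, q)` with `p ∈ ℤ^d` and `q ≥ 2` (for `q = 1` the quotient is undefined), not
necessarily in lowest terms, so that `ω(x) = ∞` for rational `x`. -/
def irrationalityExponent {d : ℕ} (x : Fin d → ℝ) : EReal :=
  limsup (approxQuality x) (cofinite ⊓ 𝓟 {r : (Fin d → ℤ) × ℕ | 2 ≤ r.2})

/-- The set `VWA_d` of very well approximable vectors, `ω(x) > 1 + 1/d`. -/
def veryWellApproximable (d : ℕ) : Set (Fin d → ℝ) :=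
  {x | ((1 + 1 / (d : ℝ) : ℝ) : EReal) < irrationalityExponent x}

/-- The exponent of irrationality is invariant under integer translations, so it is really a
function on the torus. -/
theorem irrationalityExponent_add_int {d : ℕ} (x : Fin d → ℝ) (m : Fin d → ℤ) :
    irrationalityExponent (fun i => x i + (m i : ℝ)) = irrationalityExponent x := by
  have key : ∀ (y : Fin d → ℝ) (k : Fin d → ℤ),
      irrationalityExponent (fun i => y i + (k i : ℝ)) ≤ irrationalityExponent y := by
    intro y k
    let g : (Fin d → ℤ) × ℕ → (Fin d → ℤ) × ℕ := fun r => (fun i => r.1 i - k i * (r.2 : ℤ), r.2)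
    have hg : Function.Injective g := by
      rintro ⟨p, q⟩ ⟨p', q'⟩ h
      simp only [g, Prod.mk.injEq] at h
      obtain ⟨h1, rfl⟩ := h
      refine Prod.ext (funext fun i => ?_) rfl
      have := congrFun h1 i
      simpa using this
    have ht : Tendsto g (cofinite ⊓ 𝓟 {r | 2 ≤ r.2}) (cofinite ⊓ 𝓟 {r | 2 ≤ r.2}) :=
      hg.tendsto_cofinite.inf (tendsto_principal_principal.2 fun r hr => hr)
    have hq : approxQuality (fun i => y i + (k i : ℝ))
        =ᶠ[cofinite ⊓ 𝓟 {r : (Fin d → ℤ) × ℕ | 2 ≤ r.2}] approxQuality y ∘ g := by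
      have hm : {r : (Fin d → ℤ) × ℕ | 2 ≤ r.2} ∈
          (cofinite ⊓ 𝓟 {r : (Fin d → ℤ) × ℕ | 2 ≤ r.2}) :=
        mem_inf_of_right (mem_principal_self _)
      filter_upwards [hm] with r hr
      have h2 : (2 : ℕ) ≤ r.2 := hr
      have h0 : (r.2 : ℝ) ≠ 0 := by
        have : r.2 ≠ 0 := by omega
        exact_mod_cast this
      have he : edist (fun i => y i + (k i : ℝ)) (fun i => (r.1 i : ℝ) / (r.2 : ℝ))
          = edist y (fun i => ((g r).1 i : ℝ) / ((g r).2 : ℝ)) := by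
        rw [edist_pi_def, edist_pi_def]
        congr 1
        funext i
        rw [edist_dist, edist_dist, Real.dist_eq, Real.dist_eq]
        congr 2
        simp only [g]
        push_cast
        field_simp
        ring
      simp only [approxQuality, Function.comp, he]
      rfl
    unfold irrationalityExponent
    rw [limsup_congr hq]
    calc limsup (approxQuality y ∘ g) (cofinite ⊓ 𝓟 {r | 2 ≤ r.2})
        = limsup (approxQuality y) (map g (cofinite ⊓ 𝓟 {r | 2 ≤ r.2})) := rfl
      _ ≤ limsup (approxQuality y) (cofinite ⊓ 𝓟 {r | 2 ≤ r.2}) := limsup_le_limsup_of_le ht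
  refine le_antisymm (key x m) ?_
  have h := key (fun i => x i + (m i : ℝ)) (fun i => -m i)
  simpa using h

/-- The Liouville points of `ℝ^d / ℤ^d`: the classes of the `x` with `ω(x) = ∞`. -/
def liouvillePoints (d : ℕ) : Set (UnitAddTorus (Fin d)) :=
  torusMk '' {x : Fin d → ℝ | irrationalityExponent x = ⊤}

/-- A measure on `ℝ^d / ℤ^d` is extremal if the classes of the very well approximable vectors
form a null set. -/
def IsExtremal {d : ℕ} (μ : Measure (UnitAddTorus (Fin d))) : Prop :=
  μ (torusMk '' veryWellApproximable d) = 0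

end ToralLiouville

end

/-!
Generic invariant measures of a hyperbolic toral endomorphism live on Liouville points.

The Liouville points contain the intersection of the open sets `liouvilleNhd d n`, each of which
contains all rational points of the torus (`rationalPoints_subset_liouvilleNhd`,
`iInter_liouvilleNhd_subset`). By the portmanteau theorem, giving mass `> c` to an open set is an
open condition on a measure. So it suffices that the invariant probability measures carried by
rational points are dense (`dense_invariantMeasures_rationalPoints`): then each
`liouvilleNhd d n` has full measure for generic `μ` (`eventually_residual_ae_mem_of_isOpen`). A measure that
is carried by Liouville points is not extremal because Liouville points are very well approximable.

Density is proved without ergodic theory. Cut the torus into grid cubes of side `1 / (N + 1)`. The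
transition masses `μ (cube i ∩ T⁻¹ (cube j))` of an invariant measure `μ` form a circulation on a
finite graph, because inflow and outflow at a cube both equal its mass. Birkhoff's theorem on doubly
stochastic matrices writes such a circulation as a combination of permutations along edges that the
dynamics realizes (`exists_perm_decomposition_of_circulation`). The corners of the cubes along a
cycle of such a permutation `σ` form a periodic pseudo-orbit with jumps `O(1 / N)`. To turn it into
an orbit, a linear equation `u ∘ σ - M u = e` has to be solved with a bound on `u` independent of
the length of the cycle. Hyperbolicity gives this: composition with `σ` is a sup-norm isometry, so
`‖u ∘ σ - z u‖ ≥ |1 - |z|| ‖u‖`, and the roots `z` of the minimal polynomial of `M` are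
split off one by one (`exists_norm_le_defect_add_aeval`). The a priori bound makes the operator
injective, hence bijective over `ℚ`, so the true orbits consist of rational points
(`exists_rational_shadowing`). Moving the masses of `μ` to these orbits yields an invariant measure
on rational points that converges weakly to `μ` as `N → ∞`.
-/

open MeasureTheory Filter Topology

noncomputable section

namespace ToralLiouville

/-! ### Decomposing a circulation into permutation cycles -/

/-- A nonnegative circulation `w` on a finite vertex set (inflow equals outflow at every vertex)
is carried by finitely many permutations `σ a`, each used with weight `c a` on a `σ a`-invariant
set `S a` all of whose edges `i → σ a i` are charged by `w`; the `S a` recover the vertex masses.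
The index type is `Equiv.Perm V ⊕ V`: the second summand takes care of the loops of `w`. -/
theorem exists_perm_decomposition_of_circulation {V : Type*} [Fintype V] [DecidableEq V]
    (w : V → V → ℝ) (hw0 : ∀ i j, 0 ≤ w i j) (hw : ∀ i, ∑ j, w j i = ∑ j, w i j)
    (hw1 : ∀ i, ∑ j, w i j ≤ 1) :
    ∃ (c : Equiv.Perm V ⊕ V → ℝ) (σ : Equiv.Perm V ⊕ V → Equiv.Perm V)
      (S : Equiv.Perm V ⊕ V → Finset V),
      (∀ a, 0 ≤ c a) ∧ (∀ a i, σ a i ∈ S a ↔ i ∈ S a) ∧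
      (∀ a, ∀ i ∈ S a, 0 < w i (σ a i)) ∧
      ∀ i, ∑ a, (if i ∈ S a then c a else 0) = ∑ j, w i j := by
  -- Extra loops make all row and column sums equal to `1`; Birkhoff's theorem applies.
  let D : Matrix V V ℝ := fun i j => w i j + if i = j then 1 - ∑ k, w i k else 0
  have hD : D ∈ doublyStochastic ℝ V := by
    rw [mem_doublyStochastic_iff_sum]
    refine ⟨fun i j => ?_, fun i => ?_, fun j => ?_⟩
    · have := hw0 i j
      have := hw1 i
      simp only [D]
      split_ifs <;> linarith
    · simp [D, Finset.sum_add_distrib]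
    · simp [D, Finset.sum_add_distrib, hw]
  obtain ⟨l, hl0, -, hl⟩ := exists_eq_sum_perm_of_mem_doublyStochastic hD
  have hlD : ∀ i j, ∑ σ : Equiv.Perm V, (if σ i = j then l σ else 0) = D i j := by
    intro i j
    rw [← hl, Matrix.sum_apply]
    refine Finset.sum_congr rfl fun σ _ => ?_
    simp [Equiv.Perm.permMatrix, PEquiv.toMatrix_apply, eq_comm]
  -- Fixed points of the permutations may come from the extra loops, so they are discarded and
  -- the genuine loops are put back one vertex at a time.
  refine ⟨Sum.elim l (fun v => w v v), Sum.elim id (fun _ => 1),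
    Sum.elim (fun σ => if l σ = 0 then ∅ else Finset.univ.filter fun i => σ i ≠ i)
      (fun v => if w v v = 0 then ∅ else {v}), ?_, ?_, ?_, ?_⟩
  · rintro (σ | v)
    · exact hl0 σ
    · exact hw0 v v
  · rintro (σ | v) i
    · by_cases h : l σ = 0 <;> simp [h]
    · by_cases h : w v v = 0 <;> simp [h]
  · rintro (σ | v) i hi
    · by_cases h : l σ = 0
      · simp [h] at hi
      · simp only [Sum.elim_inl, h, if_false, Finset.mem_filter, Finset.mem_univ, true_and] at hi
        have h1 : D i (σ i) = w i (σ i) := by simp [D, Ne.symm hi]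
        simp only [Sum.elim_inl, id_eq]
        rw [← h1, ← hlD]
        refine lt_of_lt_of_le (lt_of_le_of_ne (hl0 σ) (Ne.symm h)) ?_
        have := Finset.single_le_sum (f := fun τ : Equiv.Perm V => if τ i = σ i then l τ else 0)
          (fun τ _ => by split_ifs <;> simp [hl0 τ]) (Finset.mem_univ σ)
        simpa using this
    · by_cases h : w v v = 0
      · simp [h] at hi
      · simp only [Sum.elim_inr, h, if_false, Finset.mem_singleton] at hi
        subst hi
        exact lt_of_le_of_ne (hw0 i i) (Ne.symm h)
  · intro i
    rw [Fintype.sum_sum_type]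
    have h1 : ∀ σ : Equiv.Perm V, (if i ∈ (if l σ = 0 then ∅ else
        Finset.univ.filter fun i => σ i ≠ i) then l σ else 0) =
        ∑ j, if j ≠ i then (if σ i = j then l σ else 0) else 0 := by
      intro σ
      have : ∀ j, (if j ≠ i then (if σ i = j then l σ else 0) else 0)
          = if σ i = j then (if j ≠ i then l σ else 0) else 0 := by
        intro j; split_ifs <;> rfl
      simp only [this, Finset.sum_ite_eq, Finset.mem_univ, if_true]
      by_cases h : l σ = 0 <;> simp [h]
    have h2 : ∀ v : V, (if i ∈ (if w v v = 0 then (∅ : Finset V) else {v}) then w v v else 0) =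
        if i = v then w v v else 0 := by
      intro v
      by_cases h : w v v = 0 <;> simp [h]
    refine (congrArg₂ (· + ·) (Finset.sum_congr rfl fun σ _ => h1 σ)
      (Finset.sum_congr rfl fun v _ => h2 v)).trans ?_
    simp only [Finset.sum_ite_eq, Finset.mem_univ, if_true]
    rw [Finset.sum_comm]
    have h3 : ∀ j, (∑ σ : Equiv.Perm V, if j ≠ i then (if σ i = j then l σ else 0) else 0) =
        if j ≠ i then w i j else 0 := by
      intro j
      by_cases h : j = i
      · simp [h]
      · simp only [ne_eq, h, not_false_eq_true, if_true, hlD]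
        simp [D, Ne.symm h]
    simp only [h3]
    rw [← Finset.sum_filter, Finset.filter_ne', Finset.sum_erase_add _ _ (Finset.mem_univ i)]

/-! ### Shadowing of periodic pseudo-orbits -/

/-- If no root of `∏ (X - z)` lies on the unit circle, a family `u` is controlled by its defect
`u ∘ σ - B u` along any permutation `σ` and by `∏ (B - z) u`, with a constant that does not depend
on the index set. Roots are split off one at a time: permuting indices preserves the sup norm,
so `|1 - |z|| ‖u‖ ≤ ‖u ∘ σ - z u‖ ≤ ‖u ∘ σ - B u‖ + ‖(B - z) u‖`. -/
theorem exists_norm_le_defect_add_aeval {F : Type*} [NormedAddCommGroup F] [NormedSpace ℂ F]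
    (B : Module.End ℂ F) {K : ℝ} (hK0 : 0 ≤ K) (hK : ∀ v, ‖B v‖ ≤ K * ‖v‖) (s : Multiset ℂ)
    (hs : ∀ z ∈ s, ‖z‖ ≠ 1) :
    ∃ C : ℝ, 0 ≤ C ∧ ∀ (V : Type) [Fintype V] (σ : Equiv.Perm V) (u : V → F),
      ‖u‖ ≤ C * (‖fun i => u (σ i) - B (u i)‖ + ‖fun i =>
        Polynomial.aeval B (s.map fun z => Polynomial.X - Polynomial.C z).prod (u i)‖) := by
  induction s using Multiset.induction with
  | empty =>
    refine ⟨1, zero_le_one, fun V _ σ u => ?_⟩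
    simp
  | cons z s ih =>
    obtain ⟨C, hC0, hC⟩ := ih fun y hy => hs y (Multiset.mem_cons_of_mem hy)
    have hz : 0 < |1 - ‖z‖| :=
      abs_pos.2 (sub_ne_zero.2 (hs z (Multiset.mem_cons_self z s)).symm)
    refine ⟨|1 - ‖z‖|⁻¹ * (1 + C * (K + ‖z‖) + C), by positivity, fun V _ σ u => ?_⟩
    set u' : V → F := fun i => B (u i) - z • u i with hu'
    set δ := ‖fun i => u (σ i) - B (u i)‖
    have h1 := hC V σ u'
    have h2 : ‖fun i => u' (σ i) - B (u' i)‖ ≤ (K + ‖z‖) * δ := by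
      refine (pi_norm_le_iff_of_nonneg (by positivity)).2 fun i => ?_
      have : u' (σ i) - B (u' i) = B (u (σ i) - B (u i)) - z • (u (σ i) - B (u i)) := by
        simp only [hu', map_sub, map_smul, smul_sub]
        abel
      rw [this]
      have hi : ‖u (σ i) - B (u i)‖ ≤ δ := norm_le_pi_norm (fun i => u (σ i) - B (u i)) i
      calc _ ≤ ‖B (u (σ i) - B (u i))‖ + ‖z • (u (σ i) - B (u i))‖ := norm_sub_le _ _
        _ ≤ K * ‖u (σ i) - B (u i)‖ + ‖z‖ * ‖u (σ i) - B (u i)‖ := by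
          rw [norm_smul]; exact add_le_add_left (hK _) _
        _ ≤ (K + ‖z‖) * δ := by rw [← add_mul]; gcongr
    have h3 : (fun i => Polynomial.aeval B
        ((z ::ₘ s).map fun z => Polynomial.X - Polynomial.C z).prod (u i)) =
        fun i => Polynomial.aeval B (s.map fun z => Polynomial.X - Polynomial.C z).prod (u' i) := by
      funext i
      rw [Multiset.map_cons, Multiset.prod_cons, mul_comm, map_mul, Module.End.mul_apply]
      simp [hu', Algebra.algebraMap_eq_smul_one]
    rw [h3]
    set P := ‖fun i => Polynomial.aeval B
      (s.map fun z => Polynomial.X - Polynomial.C z).prod (u' i)‖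
    have hP : 0 ≤ P := norm_nonneg _
    have hδ0 : 0 ≤ δ := norm_nonneg _
    have h4 : |1 - ‖z‖| * ‖u‖ ≤ δ + ‖u'‖ := by
      have ha : ‖fun i => u (σ i)‖ = ‖u‖ := by
        apply le_antisymm
        · exact (pi_norm_le_iff_of_nonneg (norm_nonneg _)).2 fun i => norm_le_pi_norm u _
        · refine (pi_norm_le_iff_of_nonneg (norm_nonneg _)).2 fun i => ?_
          simpa using norm_le_pi_norm (fun i => u (σ i)) (σ.symm i)
      have hb : (fun i => u (σ i)) - z • u = (fun i => u (σ i) - B (u i)) + u' := by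
        funext i
        simp [hu']
      calc |1 - ‖z‖| * ‖u‖ = |‖fun i => u (σ i)‖ - ‖z • u‖| := by
            rw [ha, norm_smul, ← one_sub_mul, abs_mul, abs_of_nonneg (norm_nonneg u)]
        _ ≤ ‖(fun i => u (σ i)) - z • u‖ := abs_norm_sub_norm_le _ _
        _ ≤ δ + ‖u'‖ := by rw [hb]; exact norm_add_le _ _
    rw [mul_assoc, inv_mul_eq_div, le_div_iff₀ hz, mul_comm]
    calc |1 - ‖z‖| * ‖u‖ ≤ δ + ‖u'‖ := h4
      _ ≤ δ + C * ((K + ‖z‖) * δ + P) := by gcongr; exact h1.trans (by gcongr)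
      _ ≤ (1 + C * (K + ‖z‖) + C) * (δ + P) := by
        have : 0 ≤ (1 + C * (K + ‖z‖)) * P + C * δ := by positivity
        nlinarith

/-- Shadowing along periodic orbits for a hyperbolic integer matrix. The equation
`u ∘ σ - M u = e` along a permutation `σ` has a solution of size comparable to `e`, with a constant
that does not depend on the index set; it can be taken rational when `e` is. -/
theorem exists_rat_solution_of_hyperbolic {d : ℕ} (M : Matrix (Fin d) (Fin d) ℤ)
    (hM : ∀ z : ℂ, Module.End.HasEigenvalue (Matrix.toLin' (M.map (Int.cast : ℤ → ℂ))) z →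
      ‖z‖ ≠ 1) :
    ∃ C : ℝ, 0 ≤ C ∧ ∀ (V : Type) [Fintype V] (σ : Equiv.Perm V) (e : V → Fin d → ℚ),
      ∃ u : V → Fin d → ℚ, (∀ i, u (σ i) - (M.map (Int.cast : ℤ → ℚ)).mulVec (u i) = e i) ∧
        ∀ ε : ℝ, 0 ≤ ε → (∀ i k, |(e i k : ℝ)| ≤ ε) → ∀ i k, |(u i k : ℝ)| ≤ C * ε := by
  set B : Module.End ℂ (Fin d → ℂ) := Matrix.toLin' (M.map (Int.cast : ℤ → ℂ)) with hB
  have hm : (((minpoly ℂ B).roots.map fun z => Polynomial.X - Polynomial.C z).prod) =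
      minpoly ℂ B :=
    ((IsAlgClosed.splits (minpoly ℂ B)).eq_prod_roots_of_monic
      (minpoly.monic (Algebra.IsIntegral.isIntegral B))).symm
  obtain ⟨C, hC0, hC⟩ := exists_norm_le_defect_add_aeval B
    (norm_nonneg (LinearMap.toContinuousLinearMap B))
    (fun v => (LinearMap.toContinuousLinearMap B).le_opNorm v) (minpoly ℂ B).roots
    (fun z hz => hM z (Module.End.hasEigenvalue_iff_isRoot.2
      (Polynomial.isRoot_of_mem_roots hz)))
  rw [hm] at hC
  simp only [minpoly.aeval, LinearMap.zero_apply] at hC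
  refine ⟨C, hC0, fun V _ σ e => ?_⟩
  let L : (V → Fin d → ℚ) →ₗ[ℚ] (V → Fin d → ℚ) :=
    { toFun := fun u i => u (σ i) - (M.map (Int.cast : ℤ → ℚ)).mulVec (u i)
      map_add' := fun u v => by
        funext i
        simp only [Pi.add_apply, Matrix.mulVec_add]
        abel
      map_smul' := fun a u => by
        funext i
        simp only [Pi.smul_apply, Matrix.mulVec_smul, smul_sub, RingHom.id_apply] }
  -- The complex estimate restricts to rational families, hence `L` is injective, hence onto.
  have hbound : ∀ (u : V → Fin d → ℚ) (ε : ℝ), 0 ≤ ε → (∀ i k, |(L u i k : ℝ)| ≤ ε) →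
      ∀ i k, |(u i k : ℝ)| ≤ C * ε := by
    intro u ε hε h i k
    have h1 := hC V σ fun i k => (u i k : ℂ)
    have h2 : ‖fun i => (fun k => (u (σ i) k : ℂ)) - B fun k => (u i k : ℂ)‖ ≤ ε := by
      refine (pi_norm_le_iff_of_nonneg hε).2 fun i => (pi_norm_le_iff_of_nonneg hε).2 fun k => ?_
      have : ((fun k => (u (σ i) k : ℂ)) - B fun k => (u i k : ℂ)) k = ((L u i k : ℚ) : ℂ) := by
        simp [L, hB, Matrix.mulVec, dotProduct]
      rw [this]
      have := h i k
      rwa [← Complex.ofReal_ratCast, Complex.norm_real, Real.norm_eq_abs]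
    have h3 : ‖(u i k : ℂ)‖ ≤ ‖fun i k => (u i k : ℂ)‖ :=
      (norm_le_pi_norm (fun k => (u i k : ℂ)) k).trans
        (norm_le_pi_norm (fun i k => (u i k : ℂ)) i)
    rw [← Complex.ofReal_ratCast, Complex.norm_real, Real.norm_eq_abs] at h3
    refine h3.trans (h1.trans (mul_le_mul_of_nonneg_left ?_ hC0))
    have h0 : ‖fun _ : V => (0 : Fin d → ℂ)‖ = 0 := norm_zero
    rw [h0, add_zero]
    exact h2
  have hinj : Function.Injective L := by
    rw [← LinearMap.ker_eq_bot, LinearMap.ker_eq_bot']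
    intro u hu
    funext i k
    have := hbound u 0 le_rfl (by simp [hu]) i k
    simpa using this
  obtain ⟨u, hu⟩ := LinearMap.injective_iff_surjective.1 hinj e
  exact ⟨u, fun i => congrFun hu i, fun ε hε h => hbound u ε hε (by rwa [hu])⟩

/-! ### The torus and its grid of mesh `1 / (N + 1)` -/

/-- The representative in `[0, 1)^d` of a point of the torus. -/
def torusRep {d : ℕ} (x : UnitAddTorus (Fin d)) : Fin d → ℝ :=
  fun k => (AddCircle.equivIco 1 0 (x k) : ℝ)

theorem torusMk_torusRep {d : ℕ} (x : UnitAddTorus (Fin d)) : torusMk (torusRep x) = x := by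
  funext k
  exact AddCircle.coe_equivIco

theorem torusRep_nonneg {d : ℕ} (x : UnitAddTorus (Fin d)) (k : Fin d) : 0 ≤ torusRep x k :=
  (AddCircle.equivIco 1 0 (x k)).2.1

theorem torusRep_lt_one {d : ℕ} (x : UnitAddTorus (Fin d)) (k : Fin d) : torusRep x k < 1 :=
  (AddCircle.equivIco 1 0 (x k)).2.2.trans_eq (zero_add 1)

theorem measurable_torusRep_apply {d : ℕ} (k : Fin d) :
    Measurable fun x : UnitAddTorus (Fin d) => torusRep x k :=
  measurable_subtype_coe.comp
    ((AddCircle.measurableEquivIco 1 0).measurable.comp (measurable_pi_apply k))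

theorem torusMk_eq_iff {d : ℕ} {x y : Fin d → ℝ} :
    torusMk x = torusMk y ↔ ∃ n : Fin d → ℤ, ∀ k, x k = y k + n k := by
  have h : ∀ k, ((x k : UnitAddCircle) = (y k : UnitAddCircle)) ↔ ∃ n : ℤ, x k = y k + n := by
    intro k
    rw [← sub_eq_zero, ← AddCircle.coe_sub, AddCircle.coe_eq_zero_iff]
    refine exists_congr fun n => ?_
    rw [zsmul_eq_mul, mul_one, eq_comm, sub_eq_iff_eq_add']
  rw [funext_iff, ← Classical.skolem (p := fun k (n : ℤ) => x k = y k + n)]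
  exact forall_congr' h

theorem dist_torusMk_le {d : ℕ} {x y : Fin d → ℝ} {r : ℝ} (hr : 0 ≤ r)
    (h : ∀ k, |x k - y k| ≤ r) : dist (torusMk x) (torusMk y) ≤ r := by
  refine (dist_pi_le_iff hr).2 fun k => ?_
  rw [dist_eq_norm]
  refine le_trans ?_ (h k)
  change ‖((x k - y k : ℝ) : UnitAddCircle)‖ ≤ _
  exact (QuotientAddGroup.norm_mk_le_norm).trans_eq (Real.norm_eq_abs _)

theorem isOpenMap_torusMk {d : ℕ} : IsOpenMap (torusMk (d := d)) :=
  IsOpenMap.piMap (fun _ => QuotientAddGroup.isOpenMap_coe)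
    (by simp [QuotientAddGroup.mk_surjective])

/-- The points of the torus with rational coordinates. -/
def rationalPoints (d : ℕ) : Set (UnitAddTorus (Fin d)) :=
  Set.range fun r : Fin d → ℚ => torusMk fun k => (r k : ℝ)

/-- The index of the grid cube of side `1 / (N + 1)` that contains a point of the torus. -/
def gridCell {d : ℕ} (N : ℕ) (x : UnitAddTorus (Fin d)) : Fin d → Fin (N + 1) :=
  fun k => ⟨⌊(N + 1 : ℝ) * torusRep x k⌋₊, by
    rw [Nat.floor_lt (mul_nonneg (by positivity) (torusRep_nonneg x k))]
    push_cast
    exact mul_lt_of_lt_one_right (by positivity) (torusRep_lt_one x k)⟩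

theorem measurable_gridCell {d : ℕ} (N : ℕ) : Measurable (gridCell (d := d) N) := by
  refine measurable_pi_iff.2 fun k => measurable_to_countable' fun j => ?_
  have : (fun x : UnitAddTorus (Fin d) => gridCell N x k) ⁻¹' {j} =
      (fun x => ⌊(N + 1 : ℝ) * torusRep x k⌋₊) ⁻¹' {(j : ℕ)} := by
    ext x
    simp [gridCell, Fin.ext_iff]
  rw [this]
  exact ((measurable_torusRep_apply k).const_mul _).nat_floor (measurableSet_singleton _)

/-- The lower corner of a grid cube, with rational coordinates. -/
def gridCorner {d N : ℕ} (i : Fin d → Fin (N + 1)) : Fin d → ℚ :=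
  fun k => ((i k : ℕ) : ℚ) / (N + 1)

/-- The point of the torus given by the lower corner of a grid cube. -/
def gridPoint {d N : ℕ} (i : Fin d → Fin (N + 1)) : UnitAddTorus (Fin d) :=
  torusMk fun k => (gridCorner i k : ℝ)

theorem abs_torusRep_sub_gridCorner_le {d N : ℕ} (x : UnitAddTorus (Fin d)) (k : Fin d) :
    |torusRep x k - gridCorner (gridCell N x) k| ≤ 1 / (N + 1) := by
  have hN : (0 : ℝ) < N + 1 := by positivity
  have h0 : 0 ≤ (N + 1 : ℝ) * torusRep x k := mul_nonneg hN.le (torusRep_nonneg x k)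
  have h1 := Nat.floor_le h0
  have h2 := Nat.lt_floor_add_one ((N + 1 : ℝ) * torusRep x k)
  have h3 : torusRep x k - gridCorner (gridCell N x) k =
      ((N + 1 : ℝ) * torusRep x k - ⌊(N + 1 : ℝ) * torusRep x k⌋₊) / (N + 1) := by
    simp only [gridCorner, gridCell]
    push_cast
    field_simp
  rw [h3, abs_div, abs_of_pos hN, abs_of_nonneg (sub_nonneg.2 h1)]
  gcongr
  linarith

theorem dist_gridPoint_gridCell_le {d : ℕ} (N : ℕ) (x : UnitAddTorus (Fin d)) :
    dist x (gridPoint (gridCell N x)) ≤ 1 / (N + 1) := by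
  have h := dist_torusMk_le (x := torusRep x) (y := fun k => (gridCorner (gridCell N x) k : ℝ))
    (r := 1 / (N + 1)) (by positivity) fun k => abs_torusRep_sub_gridCorner_le x k
  rwa [torusMk_torusRep] at h

/-- A periodic itinerary through grid cubes is shadowed by periodic orbits of rational points:
the corners of the cubes form a pseudo-orbit with jumps `O(1 / N)`, and the correction that turns
it into an orbit solves the linear equation of `exists_rat_solution_of_hyperbolic`. -/
theorem exists_rational_shadowing {d : ℕ} {T : UnitAddTorus (Fin d) → UnitAddTorus (Fin d)}
    (hT : IsHyperbolicToralEndomorphism T) :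
    ∃ C : ℝ, 1 ≤ C ∧ ∀ (N : ℕ) (σ : Equiv.Perm (Fin d → Fin (N + 1)))
      (S : Finset (Fin d → Fin (N + 1))),
      (∀ i ∈ S, ∃ x, gridCell N x = i ∧ gridCell N (T x) = σ i) →
      ∃ y : (Fin d → Fin (N + 1)) → UnitAddTorus (Fin d),
        (∀ i ∈ S, T (y i) = y (σ i)) ∧ (∀ i, y i ∈ rationalPoints d) ∧
        ∀ i, dist (y i) (gridPoint i) ≤ C / (N + 1) := by
  obtain ⟨M, hMT, hM⟩ := hT
  obtain ⟨C, hC0, hC⟩ := exists_rat_solution_of_hyperbolic M hM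
  set K : ℝ := ∑ k, ∑ l, |(M k l : ℝ)|
  have hK0 : 0 ≤ K := Finset.sum_nonneg fun k _ => Finset.sum_nonneg fun l _ => abs_nonneg _
  refine ⟨max 1 (C * (K + 1)), le_max_left _ _, fun N σ S hS => ?_⟩
  -- The integer vectors `n i` measure by how much `M` moves representatives out of `[0, 1)^d`.
  have hn : ∀ i, ∃ n : Fin d → ℤ, i ∈ S →
      ∀ k, |(((M.map (Int.cast : ℤ → ℚ)).mulVec (gridCorner i) k -
        gridCorner (σ i) k - n k : ℚ) : ℝ)| ≤ (K + 1) / (N + 1) := by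
    intro i
    by_cases hi : i ∈ S
    · obtain ⟨x, rfl, hx⟩ := hS i hi
      have h1 : torusMk ((M.map (Int.cast : ℤ → ℝ)).mulVec (torusRep x)) =
          torusMk (torusRep (T x)) := by
        rw [← hMT, torusMk_torusRep, torusMk_torusRep]
      obtain ⟨n, hn⟩ := torusMk_eq_iff.1 h1
      refine ⟨n, fun _ k => ?_⟩
      rw [← hx]
      have h2 : (((M.map (Int.cast : ℤ → ℚ)).mulVec (gridCorner (gridCell N x)) k -
          gridCorner (gridCell N (T x)) k - n k : ℚ) : ℝ) =
          (torusRep (T x) k - gridCorner (gridCell N (T x)) k) -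
          ∑ l, (M k l : ℝ) * (torusRep x l - gridCorner (gridCell N x) l) := by
        have h3 := hn k
        simp only [Matrix.mulVec, dotProduct, Matrix.map_apply] at h3 ⊢
        simp only [mul_sub, Finset.sum_sub_distrib]
        push_cast
        linarith
      rw [h2]
      have h4 : |∑ l, (M k l : ℝ) * (torusRep x l - gridCorner (gridCell N x) l)| ≤
          K * (1 / (N + 1)) := by
        calc _ ≤ ∑ l, |(M k l : ℝ) * (torusRep x l - gridCorner (gridCell N x) l)| :=
              Finset.abs_sum_le_sum_abs _ _
          _ ≤ ∑ l, |(M k l : ℝ)| * (1 / (N + 1)) := by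
              refine Finset.sum_le_sum fun l _ => ?_
              rw [abs_mul]
              exact mul_le_mul_of_nonneg_left (abs_torusRep_sub_gridCorner_le x l) (abs_nonneg _)
          _ = (∑ l, |(M k l : ℝ)|) * (1 / (N + 1)) := (Finset.sum_mul _ _ _).symm
          _ ≤ K * (1 / (N + 1)) := by
              refine mul_le_mul_of_nonneg_right ?_ (by positivity)
              exact Finset.single_le_sum (f := fun k => ∑ l, |(M k l : ℝ)|)
                (fun k _ => Finset.sum_nonneg fun l _ => abs_nonneg _) (Finset.mem_univ k)
      calc _ ≤ |torusRep (T x) k - gridCorner (gridCell N (T x)) k| +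
            |∑ l, (M k l : ℝ) * (torusRep x l - gridCorner (gridCell N x) l)| := abs_sub _ _
        _ ≤ 1 / (N + 1) + K * (1 / (N + 1)) :=
            add_le_add (abs_torusRep_sub_gridCorner_le _ _) h4
        _ = (K + 1) / (N + 1) := by ring
    · exact ⟨0, fun h => absurd h hi⟩
  choose n hn using hn
  let e : (Fin d → Fin (N + 1)) → Fin d → ℚ := fun i =>
    if i ∈ S then fun k => (M.map (Int.cast : ℤ → ℚ)).mulVec (gridCorner i) k -
      gridCorner (σ i) k - n i k else 0
  have he : ∀ i k, |(e i k : ℝ)| ≤ (K + 1) / (N + 1) := by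
    intro i k
    by_cases hi : i ∈ S
    · simp only [e, hi, if_true]
      exact hn i hi k
    · simp only [e, hi, if_false, Pi.zero_apply, Rat.cast_zero, abs_zero]
      positivity
  obtain ⟨u, hu, hub⟩ := hC _ σ e
  refine ⟨fun i => torusMk fun k => ((gridCorner i k + u i k : ℚ) : ℝ), fun i hi => ?_,
    fun i => ⟨fun k => gridCorner i k + u i k, rfl⟩, fun i => ?_⟩
  · rw [hMT, torusMk_eq_iff]
    refine ⟨n i, fun k => ?_⟩
    have h1 := congrFun (hu i) k
    simp only [e, hi, if_true, Pi.sub_apply] at h1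
    have h2 : (M.map (Int.cast : ℤ → ℝ)).mulVec (fun k => ((gridCorner i k + u i k : ℚ) : ℝ)) k =
        (((M.map (Int.cast : ℤ → ℚ)).mulVec (gridCorner i) k +
          (M.map (Int.cast : ℤ → ℚ)).mulVec (u i) k : ℚ) : ℝ) := by
      simp [Matrix.mulVec, dotProduct, mul_add, Finset.sum_add_distrib]
    rw [h2]
    have h3 : (M.map (Int.cast : ℤ → ℚ)).mulVec (gridCorner i) k +
        (M.map (Int.cast : ℤ → ℚ)).mulVec (u i) k =
        gridCorner (σ i) k + u (σ i) k + n i k := by linarith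
    rw [h3]
    push_cast
    ring
  · refine dist_torusMk_le (by positivity) fun k => ?_
    have h1 := hub ((K + 1) / (N + 1)) (by positivity) he i k
    have h2 : ((gridCorner i k + u i k : ℚ) : ℝ) - gridCorner i k = u i k := by
      push_cast
      ring
    rw [h2]
    refine h1.trans ?_
    rw [← mul_div_assoc]
    gcongr
    exact le_max_right _ _

/-! ### Approximation of invariant measures by measures on rational points -/

/-- An invariant probability measure, seen through a finite measurable partition `g`, decomposes
into cycles of a permutation all of whose edges `i → σ a i` are realized by the dynamics: the
transition masses `μ (g = i, g ∘ T = j)` form a circulation, by invariance. -/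
theorem exists_perm_decomposition_of_measurePreserving {X V : Type*} [MeasurableSpace X]
    [Fintype V] [DecidableEq V] [MeasurableSpace V] [MeasurableSingletonClass V]
    {T : X → X} {μ : Measure X} [IsProbabilityMeasure μ] (hT : MeasurePreserving T μ μ)
    {g : X → V} (hg : Measurable g) :
    ∃ (c : Equiv.Perm V ⊕ V → ℝ) (σ : Equiv.Perm V ⊕ V → Equiv.Perm V)
      (S : Equiv.Perm V ⊕ V → Finset V),
      (∀ a, 0 ≤ c a) ∧ (∀ a i, σ a i ∈ S a ↔ i ∈ S a) ∧
      (∀ a, ∀ i ∈ S a, ∃ x, g x = i ∧ g (T x) = σ a i) ∧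
      ∀ i, ∑ a, (if i ∈ S a then c a else 0) = μ.real (g ⁻¹' {i}) := by
  have hgm : ∀ i, MeasurableSet (g ⁻¹' {i}) := fun i => hg (measurableSet_singleton i)
  have hgT : ∀ i, MeasurableSet ((fun x => g (T x)) ⁻¹' {i}) := fun i =>
    (hg.comp hT.measurable) (measurableSet_singleton i)
  let w : V → V → ℝ := fun i j => μ.real (g ⁻¹' {i} ∩ (fun x => g (T x)) ⁻¹' {j})
  have hout : ∀ i, ∑ j, w i j = μ.real (g ⁻¹' {i}) := by
    intro i
    have h := sum_measureReal_preimage_singleton (μ := μ.restrict (g ⁻¹' {i})) Finset.univ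
      (f := fun x => g (T x)) (fun j _ => hgT j)
    simp only [Finset.coe_univ, Set.preimage_univ, measureReal_restrict_apply_univ] at h
    rw [← h]
    refine Finset.sum_congr rfl fun j _ => ?_
    rw [measureReal_restrict_apply (hgT j), Set.inter_comm]
  have hin : ∀ i, ∑ j, w j i = μ.real (g ⁻¹' {i}) := by
    intro i
    have h := sum_measureReal_preimage_singleton
      (μ := μ.restrict ((fun x => g (T x)) ⁻¹' {i})) Finset.univ (f := g) (fun j _ => hgm j)
    simp only [Finset.coe_univ, Set.preimage_univ, measureReal_restrict_apply_univ] at h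
    have h2 : μ.real ((fun x => g (T x)) ⁻¹' {i}) = μ.real (g ⁻¹' {i}) :=
      hT.measureReal_preimage (hgm i).nullMeasurableSet
    rw [← h2, ← h]
    refine Finset.sum_congr rfl fun j _ => ?_
    rw [measureReal_restrict_apply (hgm j)]
  obtain ⟨c, σ, S, h0, h1, h2, h3⟩ := exists_perm_decomposition_of_circulation w
    (fun _ _ => measureReal_nonneg) (fun i => (hin i).trans (hout i).symm)
    (fun i => (hout i).trans_le measureReal_le_one)
  refine ⟨c, σ, S, h0, h1, fun a i hi => ?_, fun i => (h3 i).trans (hout i)⟩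
  have h : (g ⁻¹' {i} ∩ (fun x => g (T x)) ⁻¹' {σ a i}).Nonempty := by
    by_contra h
    have := h2 a i hi
    simp only [w, Set.not_nonempty_iff_eq_empty.1 h, measureReal_empty, lt_irrefl] at this
  exact h

/-- The atomic measure with an atom of mass `c a` at `y a i` for each `a` and `i ∈ S a`. -/
def atomicMeasure {X A V : Type*} [MeasurableSpace X] [Fintype A] (c : A → ℝ) (S : A → Finset V)
    (y : A → V → X) : Measure X :=
  ∑ a, ∑ i ∈ S a, ENNReal.ofReal (c a) • Measure.dirac (y a i)

section atomicMeasure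

variable {X A V : Type*} [MeasurableSpace X] [Fintype A] {c : A → ℝ}
  {S : A → Finset V} {y : A → V → X}

theorem atomicMeasure_apply {s : Set X} (hs : MeasurableSet s) :
    atomicMeasure c S y s =
      ∑ a, ∑ i ∈ S a, ENNReal.ofReal (c a) * s.indicator 1 (y a i) := by
  simp [atomicMeasure, Measure.finsetSum_apply, Measure.dirac_apply' _ hs]

theorem sum_sum_mem_eq [Fintype V] [DecidableEq V] {M : Type*} [AddCommMonoid M]
    (S : A → Finset V) (F : A → V → M) :
    ∑ a, ∑ i ∈ S a, F a i = ∑ i, ∑ a, if i ∈ S a then F a i else 0 := by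
  rw [Finset.sum_comm]
  refine Finset.sum_congr rfl fun a _ => ?_
  rw [Finset.sum_ite_mem, Finset.univ_inter]

theorem integral_atomicMeasure [Fintype V] [DecidableEq V] [MeasurableSingletonClass X]
    (hc : ∀ a, 0 ≤ c a) (f : X → ℝ) :
    ∫ x, f x ∂atomicMeasure c S y = ∑ i, ∑ a, (if i ∈ S a then c a * f (y a i) else 0) := by
  have hi : ∀ a i, Integrable f (ENNReal.ofReal (c a) • Measure.dirac (y a i)) := fun a i =>
    (integrable_dirac (by simp)).smul_measure ENNReal.ofReal_ne_top
  rw [← sum_sum_mem_eq, atomicMeasure, integral_finsetSum_measure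
    fun a _ => integrable_finsetSum_measure.2 fun i _ => hi a i]
  refine Finset.sum_congr rfl fun a _ => ?_
  rw [integral_finsetSum_measure fun i _ => hi a i]
  refine Finset.sum_congr rfl fun i _ => ?_
  rw [integral_smul_measure, integral_dirac, ENNReal.toReal_ofReal (hc a), smul_eq_mul]

theorem measurePreserving_atomicMeasure {T : X → X} (hT : Measurable T)
    {σ : A → Equiv.Perm V} (hσ : ∀ a i, σ a i ∈ S a ↔ i ∈ S a)
    (hy : ∀ a, ∀ i ∈ S a, T (y a i) = y a (σ a i)) :
    MeasurePreserving T (atomicMeasure c S y) (atomicMeasure c S y) := by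
  refine ⟨hT, ?_⟩
  ext s hs
  rw [Measure.map_apply hT hs, atomicMeasure_apply hs, atomicMeasure_apply (hT hs)]
  refine Finset.sum_congr rfl fun a _ => ?_
  refine Finset.sum_nbij (σ a) (fun i hi => (hσ a i).2 hi) (σ a).injective.injOn
    (fun i hi => ⟨(σ a).symm i, by
      simpa using (hσ a ((σ a).symm i)).1 (by simpa using hi), by simp⟩) fun i hi => ?_
  rw [← hy a i hi]
  rfl

end atomicMeasure

/-- At every scale `1 / (N + 1)` an invariant probability measure is close to an invariant
probability measure carried by rational points, in the sense that both are close to the same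
measure on the grid. -/
theorem exists_rational_approximation {d : ℕ}
    {T : UnitAddTorus (Fin d) → UnitAddTorus (Fin d)} (hT : IsHyperbolicToralEndomorphism T) :
    ∃ C : ℝ, ∀ (μ : InvariantMeasures T) (N : ℕ), ∃ ν : InvariantMeasures T,
      (ν.1 : Measure (UnitAddTorus (Fin d))) (rationalPoints d) = 1 ∧
      ∀ (f : BoundedContinuousFunction (UnitAddTorus (Fin d)) ℝ) (ε : ℝ),
        (∀ x y, dist x y ≤ C / (N + 1) → |f x - f y| ≤ ε) →
        |∫ x, f x ∂(ν.1 : Measure (UnitAddTorus (Fin d))) -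
          ∫ x, f x ∂(μ.1 : Measure (UnitAddTorus (Fin d)))| ≤ 2 * ε := by
  obtain ⟨C, hC1, hC⟩ := exists_rational_shadowing hT
  refine ⟨C, fun μ N => ?_⟩
  set m : Measure (UnitAddTorus (Fin d)) := (μ.1 : Measure (UnitAddTorus (Fin d)))
  have hg := measurable_gridCell (d := d) N
  obtain ⟨c, σ, S, hc, hσ, hS, hw⟩ := exists_perm_decomposition_of_measurePreserving μ.2 hg
  choose y hy1 hy2 hy3 using fun a => hC N (σ a) (S a) (hS a)
  have htot : ∑ i, m.real (gridCell N ⁻¹' {i}) = 1 := by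
    rw [sum_measureReal_preimage_singleton _ fun i _ => hg (measurableSet_singleton i)]
    simp
  have hcount : (rationalPoints d).Countable := Set.countable_range _
  have hmass : ∀ s : Set (UnitAddTorus (Fin d)), MeasurableSet s → (∀ a i, y a i ∈ s) →
      atomicMeasure c S y s = 1 := by
    intro s hs hys
    rw [atomicMeasure_apply hs, sum_sum_mem_eq]
    have h : ∀ i, (∑ a, if i ∈ S a then
        ENNReal.ofReal (c a) * s.indicator (1 : UnitAddTorus (Fin d) → ENNReal) (y a i) else 0) =
        ENNReal.ofReal (m.real (gridCell N ⁻¹' {i})) := by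
      intro i
      rw [← hw i, ENNReal.ofReal_sum_of_nonneg fun a _ => by split_ifs <;> simp [hc a]]
      refine Finset.sum_congr rfl fun a _ => ?_
      rw [Set.indicator_of_mem (hys a i)]
      split_ifs <;> simp
    rw [Finset.sum_congr rfl fun i _ => h i,
      ← ENNReal.ofReal_sum_of_nonneg fun i _ => measureReal_nonneg, htot, ENNReal.ofReal_one]
  refine ⟨⟨⟨atomicMeasure c S y, ⟨hmass _ MeasurableSet.univ fun _ _ => Set.mem_univ _⟩⟩,
    measurePreserving_atomicMeasure μ.2.measurable hσ hy1⟩,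
    hmass _ hcount.measurableSet hy2, fun f ε hf => ?_⟩
  have hN : (0 : ℝ) < N + 1 := by positivity
  have hgrid : ∫ x, f (gridPoint (gridCell N x)) ∂m =
      ∑ i, m.real (gridCell N ⁻¹' {i}) * f (gridPoint i) := by
    rw [← integral_map (φ := gridCell N) (f := fun i => f (gridPoint i)) hg.aemeasurable
      (measurable_of_finite _).aestronglyMeasurable]
    rw [integral_fintype (Integrable.of_finite)]
    refine Finset.sum_congr rfl fun i _ => ?_
    rw [map_measureReal_apply hg (measurableSet_singleton i), smul_eq_mul]
  have h1 : |∫ x, f (gridPoint (gridCell N x)) ∂m - ∫ x, f x ∂m| ≤ ε := by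
    have hi : Integrable (fun x => f (gridPoint (gridCell N x))) m :=
      Integrable.of_bound (((measurable_of_finite fun i : Fin d → Fin (N + 1) =>
        f (gridPoint i)).comp hg).aestronglyMeasurable) ‖f‖
        (Eventually.of_forall fun x => f.norm_coe_le_norm _)
    rw [← integral_sub hi (f.integrable m), ← Real.norm_eq_abs]
    refine (norm_integral_le_of_norm_le_const (Eventually.of_forall fun x => ?_)).trans_eq
      (by rw [probReal_univ, mul_one])
    rw [Real.norm_eq_abs, abs_sub_comm]
    exact hf _ _ ((dist_gridPoint_gridCell_le N x).trans (by gcongr))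
  have h2 : |∫ x, f x ∂atomicMeasure c S y - ∫ x, f (gridPoint (gridCell N x)) ∂m| ≤ ε := by
    rw [integral_atomicMeasure hc, hgrid, ← Finset.sum_sub_distrib]
    calc _ ≤ ∑ i, |(∑ a, if i ∈ S a then c a * f (y a i) else 0) -
            m.real (gridCell N ⁻¹' {i}) * f (gridPoint i)| := Finset.abs_sum_le_sum_abs _ _
      _ ≤ ∑ i, m.real (gridCell N ⁻¹' {i}) * ε := by
        refine Finset.sum_le_sum fun i _ => ?_
        rw [← hw i, Finset.sum_mul, ← Finset.sum_sub_distrib, Finset.sum_mul]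
        refine (Finset.abs_sum_le_sum_abs _ _).trans (Finset.sum_le_sum fun a _ => ?_)
        split_ifs
        · rw [← mul_sub, abs_mul, abs_of_nonneg (hc a)]
          exact mul_le_mul_of_nonneg_left (hf _ _ (hy3 a i)) (hc a)
        · simp
      _ = ε := by rw [← Finset.sum_mul, htot, one_mul]
  rw [two_mul]
  exact (abs_sub_le _ _ _).trans (add_le_add h2 h1)

/-- The invariant probability measures carried by rational points are dense. -/
theorem dense_invariantMeasures_rationalPoints {d : ℕ}
    {T : UnitAddTorus (Fin d) → UnitAddTorus (Fin d)} (hT : IsHyperbolicToralEndomorphism T) :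
    Dense {ν : InvariantMeasures T |
      (ν.1 : Measure (UnitAddTorus (Fin d))) (rationalPoints d) = 1} := by
  obtain ⟨C, hC⟩ := exists_rational_approximation hT
  intro μ
  choose ν hν1 hν2 using hC μ
  refine mem_closure_of_tendsto (f := ν) (b := atTop) ?_ (Eventually.of_forall hν1)
  rw [tendsto_subtype_rng, ProbabilityMeasure.tendsto_iff_forall_integral_tendsto]
  intro f
  rw [Metric.tendsto_nhds]
  intro ε hε
  obtain ⟨δ, hδ, h⟩ := Metric.uniformContinuous_iff.1
    (CompactSpace.uniformContinuous_of_continuous f.continuous) (ε / 3) (by positivity)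
  have hlim : Tendsto (fun N : ℕ => C / ((N : ℝ) + 1)) atTop (𝓝 0) := by
    have := (tendsto_one_div_add_atTop_nhds_zero_nat (𝕜 := ℝ)).const_mul C
    simpa [div_eq_mul_inv] using this
  filter_upwards [hlim.eventually (gt_mem_nhds hδ)] with N hN
  rw [Real.dist_eq]
  refine (hν2 N f (ε / 3) fun x y hxy => (h (hxy.trans_lt hN)).le).trans_lt ?_
  linarith

/-! ### Liouville points as a countable intersection of open sets -/

/-- The points of the torus within distance `q ^ (-n)` of some `p / q` with `q ≥ n + 2`. -/
def liouvilleNhd (d n : ℕ) : Set (UnitAddTorus (Fin d)) :=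
  ⋃ (p : Fin d → ℤ) (q : ℕ) (_ : n + 2 ≤ q),
    torusMk '' Metric.ball (fun i => (p i : ℝ) / (q : ℝ)) (((q : ℝ) ^ n)⁻¹)

theorem isOpen_liouvilleNhd (d n : ℕ) : IsOpen (liouvilleNhd d n) :=
  isOpen_iUnion fun _ => isOpen_iUnion fun _ => isOpen_iUnion fun _ =>
    isOpenMap_torusMk _ Metric.isOpen_ball

theorem rationalPoints_subset_liouvilleNhd (d n : ℕ) : rationalPoints d ⊆ liouvilleNhd d n := by
  rintro _ ⟨r, rfl⟩
  -- A common denominator `Q` of the coordinates, blown up to be at least `n + 2`.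
  set Q : ℕ := ∏ i, (r i).den
  have hQ0 : 0 < Q := Finset.prod_pos fun i _ => (r i).den_pos
  have hQ' : ∀ i, ∃ p : ℤ, (r i : ℝ) = p / ((Q * (n + 2) : ℕ) : ℝ) := by
    intro i
    obtain ⟨m, hm⟩ : (r i).den ∣ Q := Finset.dvd_prod_of_mem _ (Finset.mem_univ i)
    have hm0 : m ≠ 0 := by
      rintro rfl
      omega
    refine ⟨(r i).num * m * (n + 2), ?_⟩
    have h1 : ((r i).den : ℝ) ≠ 0 := by exact_mod_cast (r i).den_nz
    have h2 : (m : ℝ) ≠ 0 := by exact_mod_cast hm0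
    have h3 : (n + 2 : ℝ) ≠ 0 := by positivity
    rw [hm]
    push_cast
    rw [Rat.cast_def]
    field_simp
  choose p hp using hQ'
  have hq : n + 2 ≤ Q * (n + 2) := Nat.le_mul_of_pos_left _ hQ0
  simp only [liouvilleNhd, Set.mem_iUnion]
  refine ⟨p, Q * (n + 2), hq, _, Metric.mem_ball_self ?_, ?_⟩
  · have : (0 : ℝ) < (Q * (n + 2) : ℕ) := by
      have : 0 < Q * (n + 2) := by omega
      exact_mod_cast this
    positivity
  · exact congrArg torusMk (funext fun i => (hp i).symm)

theorem le_approxQuality {d n : ℕ} {x : Fin d → ℝ} {p : Fin d → ℤ} {q : ℕ} (hq : 2 ≤ q)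
    (h : dist x (fun i => (p i : ℝ) / (q : ℝ)) < ((q : ℝ) ^ n)⁻¹) :
    (n : EReal) ≤ approxQuality x (p, q) := by
  have hq1 : (1 : ℝ) < q := by exact_mod_cast hq
  have hlog : 0 < Real.log q := Real.log_pos hq1
  have hpos : (0 : ℝ) < ((q : ℝ) ^ n)⁻¹ := by positivity
  have h1 : ENNReal.log (edist x (fun i => (p i : ℝ) / (q : ℝ))) ≤
      ((-(n * Real.log q) : ℝ) : EReal) := by
    rw [edist_dist]
    refine (ENNReal.log_monotone (ENNReal.ofReal_le_ofReal h.le)).trans_eq ?_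
    rw [ENNReal.log_ofReal_of_pos hpos, Real.log_inv, Real.log_pow]
  unfold approxQuality
  rw [EReal.le_div_iff_mul_le (by exact_mod_cast hlog) (EReal.coe_ne_top _)]
  have h2 := EReal.neg_le_neg_iff.2 h1
  rw [← EReal.coe_neg, neg_neg] at h2
  refine le_trans (le_of_eq ?_) h2
  rw [EReal.coe_mul]
  rfl

theorem iInter_liouvilleNhd_subset (d : ℕ) : ⋂ n, liouvilleNhd d n ⊆ liouvillePoints d := by
  intro x hx
  refine ⟨torusRep x, ?_, torusMk_torusRep x⟩
  -- Approximations of other lifts of `x` are translated into approximations of `torusRep x`.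
  have h : ∀ n : ℕ, ∃ (p : Fin d → ℤ) (q : ℕ), n + 2 ≤ q ∧
      (n : EReal) ≤ approxQuality (torusRep x) (p, q) := by
    intro n
    have hn := Set.mem_iInter.1 hx n
    simp only [liouvilleNhd, Set.mem_iUnion] at hn
    obtain ⟨p, q, hq, x', hx', hxx⟩ := hn
    rw [← torusMk_torusRep x, eq_comm, torusMk_eq_iff] at hxx
    obtain ⟨k, hk⟩ := hxx
    have hq0 : (q : ℝ) ≠ 0 := by
      have : q ≠ 0 := by omega
      exact_mod_cast this
    refine ⟨fun i => p i + k i * q, q, hq, le_approxQuality (by omega) ?_⟩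
    rw [Metric.mem_ball] at hx'
    convert hx' using 1
    rw [dist_pi_def, dist_pi_def]
    congr 2
    funext i
    rw [← NNReal.coe_inj, coe_nndist, coe_nndist, Real.dist_eq, Real.dist_eq, hk]
    congr 1
    push_cast
    field_simp
    ring
  choose p q hq hpq using h
  change irrationalityExponent (torusRep x) = ⊤
  rw [EReal.eq_top_iff_forall_lt]
  intro b
  obtain ⟨n, hn⟩ := exists_nat_gt b
  have hbn : (b : EReal) < (n : EReal) := by exact_mod_cast hn
  refine hbn.trans_le (le_limsup_of_frequently_le ?_)
  rw [frequently_inf_principal, frequently_cofinite_iff_infinite]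
  -- The denominators of the good approximations are unbounded, so there are infinitely many.
  refine Set.infinite_of_forall_exists_gt (α := ℕ) (s := Prod.snd '' _) (fun N => ?_)
    |>.of_image Prod.snd
  refine ⟨q (max n N), ⟨(p (max n N), q (max n N)), ⟨?_, ?_⟩, rfl⟩, ?_⟩
  · have := hq (max n N)
    show 2 ≤ q (max n N)
    omega
  · refine le_trans ?_ (hpq (max n N))
    exact_mod_cast le_max_left n N
  · have := hq (max n N)
    have := le_max_right n N
    omega

/-! ### Genericity -/

/-- If the invariant measures carried by a set `R` are dense, then generic invariant measures
are carried by any given open set containing `R`. -/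
theorem eventually_residual_ae_mem_of_isOpen {d : ℕ}
    {T : UnitAddTorus (Fin d) → UnitAddTorus (Fin d)} {R U : Set (UnitAddTorus (Fin d))}
    (hR : Dense {ν : InvariantMeasures T | (ν.1 : Measure (UnitAddTorus (Fin d))) R = 1})
    (hU : IsOpen U) (hRU : R ⊆ U) :
    ∀ᶠ μ in residual (InvariantMeasures T),
      ∀ᵐ x ∂(μ.1 : Measure (UnitAddTorus (Fin d))), x ∈ U := by
  have h : ∀ c : ENNReal, c < 1 → {μ : InvariantMeasures T |
      c < (μ.1 : Measure (UnitAddTorus (Fin d))) U} ∈ residual (InvariantMeasures T) := by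
    intro c hc
    refine residual_of_dense_open (isOpen_iff_mem_nhds.2 fun μ hμ => ?_) (hR.mono fun ν hν => ?_)
    · have h1 := ProbabilityMeasure.le_liminf_measure_open_of_tendsto
        (continuous_subtype_val.tendsto μ) hU
      exact eventually_lt_of_lt_liminf (lt_of_lt_of_le hμ h1)
    · exact hc.trans_le ((Eq.ge hν).trans (measure_mono hRU))
  obtain ⟨c, -, hc1, hc⟩ := exists_seq_strictMono_tendsto' (zero_lt_one (α := ENNReal))
  have h2 : ∀ᶠ μ in residual (InvariantMeasures T),
      ∀ n, c n < (μ.1 : Measure (UnitAddTorus (Fin d))) U :=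
    eventually_countable_forall.2 fun n => h _ (hc1 n).2
  filter_upwards [h2] with μ hμ
  have h3 : (μ.1 : Measure (UnitAddTorus (Fin d))) U = 1 :=
    le_antisymm prob_le_one (le_of_tendsto' hc fun n => (hμ n).le)
  exact (mem_ae_iff_prob_eq_one hU.measurableSet).2 h3

end ToralLiouville

end

theorem mainTheorem9 (d : ℕ) (hd : 1 ≤ d) (T : UnitAddTorus (Fin d) → UnitAddTorus (Fin d))
    (hT : ToralLiouville.IsHyperbolicToralEndomorphism T) :
    {μ : ToralLiouville.InvariantMeasures T |
        ∀ᵐ x ∂(μ.1 : Measure (UnitAddTorus (Fin d))), x ∈ ToralLiouville.liouvillePoints d}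
      ∈ residual (ToralLiouville.InvariantMeasures T) ∧
    {μ : ToralLiouville.InvariantMeasures T |
        ¬ ToralLiouville.IsExtremal (μ.1 : Measure (UnitAddTorus (Fin d)))}
      ∈ residual (ToralLiouville.InvariantMeasures T) := by
  have h : {μ : ToralLiouville.InvariantMeasures T |
      ∀ᵐ x ∂(μ.1 : Measure (UnitAddTorus (Fin d))), x ∈ ToralLiouville.liouvillePoints d}
      ∈ residual (ToralLiouville.InvariantMeasures T) := by
    have h1 : ∀ᶠ μ in residual (ToralLiouville.InvariantMeasures T), ∀ n : ℕ,
        ∀ᵐ x ∂(μ.1 : Measure (UnitAddTorus (Fin d))), x ∈ ToralLiouville.liouvilleNhd d n :=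
      eventually_countable_forall.2 fun n =>
        ToralLiouville.eventually_residual_ae_mem_of_isOpen
          (ToralLiouville.dense_invariantMeasures_rationalPoints hT)
          (ToralLiouville.isOpen_liouvilleNhd d n)
          (ToralLiouville.rationalPoints_subset_liouvilleNhd d n)
    filter_upwards [h1] with μ hμ
    filter_upwards [ae_all_iff.2 hμ] with x hx
    exact ToralLiouville.iInter_liouvilleNhd_subset d (Set.mem_iInter.2 hx)
  refine ⟨h, ?_⟩
  filter_upwards [h] with μ hμ hext
  have hsub : ToralLiouville.liouvillePoints d ⊆
      ToralLiouville.torusMk '' ToralLiouville.veryWellApproximable d := by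
    refine Set.image_mono fun x (hx : ToralLiouville.irrationalityExponent x = ⊤) => ?_
    change _ < ToralLiouville.irrationalityExponent x
    rw [hx]
    exact EReal.coe_lt_top _
  have hnot : ∀ᵐ x ∂(μ.1 : Measure (UnitAddTorus (Fin d))),
      x ∉ ToralLiouville.torusMk '' ToralLiouville.veryWellApproximable d :=
    measure_eq_zero_iff_ae_notMem.1 hext
  obtain ⟨x, hx1, hx2⟩ := (hμ.and hnot).exists
  exact hx2 (hsub hx1)
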